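/- For a set $S$ of cardinality $\omega_1$, let $\lambda_{\omega_1}$ be the standard product probability measure on $2^{\omega_1}=\{0,1\}^{S}$ (each factor $\{0,1\}$ carrying the measure that gives mass $1/2$ to each point), let $\mathcal N_{\omega_1}$ be the ideal of $\lambda_{\omega_1}$-null subsets of $2^{\omega_1}$, and let $\mathrm{cov}(\mathcal N_{\omega_1})$ be the least cardinality of a family $\mathcal A\subseteq\mathcal N_{\omega_1}$ with $\bigcup\mathcal A=2^{\omega_1}$. Assume $\mathrm{cov}(\mathcal N_{\omega_1})>\omega_1$. Let $K$ be a compact Hausdorff space such that - $K$ is countably tight: whenever $x\in\overline{A}$ for some $A\subseteq K$, there is a countable $B\subseteq A$ with $x\in\overline{B}$; and - $K$ supports a measure: there is a finite Borel measure $\mu$ on $K$ which is Radon (inner regular with respect to compact sets) and satisfies $\mu(U)>0$ for every nonempty open $U\subseteq K$. Then $K$ has a countable $\pi$-base: there is a countable family $\mathcal P$ of nonempty open subsets of $K$ such that every nonempty open $V\subseteq K$ contains some $U\in\mathcal P$. -/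

import Mathlib

open MeasureTheory Cardinal

universe u

namespace SmallCompacta

/-- The ideal `𝒩_μ` of `μ`-null sets. In Mathlib `μ A` is the outer measure of an arbitrary set `A`,
so `A` is in the ideal iff it is contained in a measurable set of measure zero. -/
def nullIdeal {X : Type u} [MeasurableSpace X] (μ : Measure X) : Order.Ideal (Set X) where
  carrier := {A | μ A = 0}
  lower' := fun _ _ hBA hA => measure_mono_null hBA hA
  nonempty' := ⟨∅, measure_empty⟩
  directed' := fun A hA B hB =>
    ⟨A ∪ B, measure_union_null hA hB, Set.subset_union_left, Set.subset_union_right⟩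

/-- `cov(𝓘)`: the smallest cardinality of a subfamily of the ideal `𝓘` that covers `X`. -/
noncomputable def cov {X : Type u} (I : Order.Ideal (Set X)) : Cardinal.{u} :=
  sInf {c | ∃ 𝒜 : Set (Set X), (∀ A ∈ 𝒜, A ∈ I) ∧ ⋃₀ 𝒜 = Set.univ ∧ #𝒜 = c}

/-- The cube `2^κ`, as the set of functions from a set of cardinality `κ` to `{0, 1}`. -/
abbrev Cube (κ : Cardinal.{u}) : Type u := κ.out → Bool

/-- The standard product measure `λ_κ` on `2^κ`, the power of the measure on `{0, 1}` that gives
each point the mass `1/2`. It is given on the product σ-algebra; the Borel sets of `2^κ` lie in its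
completion, so it has the same null sets as its extension to the Borel sets. -/
noncomputable def cubeMeasure (κ : Cardinal.{u}) : Measure (Cube κ) :=
  Measure.infinitePi fun _ : κ.out => (PMF.uniformOfFintype Bool).toMeasure

/-- The ideal `𝒩_κ` of `λ_κ`-null subsets of `2^κ`. -/
noncomputable def cubeNullIdeal (κ : Cardinal.{u}) : Order.Ideal (Set (Cube κ)) :=
  nullIdeal (cubeMeasure κ)

/-- Countable tightness: a point in the closure of a set is in the closure of a countable subset. -/
def CountablyTight (K : Type u) [TopologicalSpace K] : Prop :=
  ∀ (A : Set K) (x : K), x ∈ closure A → ∃ B : Set K, B ⊆ A ∧ B.Countable ∧ x ∈ closure B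

/-- `K` supports a measure: there is a finite Borel measure on `K`, inner regular with respect to
compact sets (Radon), which is positive on every nonempty open set. -/
def SupportsMeasure (K : Type u) [TopologicalSpace K] [MeasurableSpace K] [BorelSpace K] : Prop :=
  ∃ μ : Measure K, IsFiniteMeasure μ ∧ μ.InnerRegular ∧
    ∀ U : Set K, IsOpen U → U.Nonempty → 0 < μ U

/-- `P` is a π-base of `K`: a family of nonempty open sets such that every nonempty open set
contains a member of the family. -/
def IsPiBase {K : Type u} [TopologicalSpace K] (P : Set (Set K)) : Prop :=
  (∀ U ∈ P, IsOpen U ∧ U.Nonempty) ∧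
    ∀ V : Set K, IsOpen V → V.Nonempty → ∃ U ∈ P, U ⊆ V

end SmallCompacta

/-!
Suppose `K` has no countable π-base. By recursion of length `ω₁` one finds disjoint pairs of zero
sets `F i`, `H i`, where `F i` has nonempty interior and `H i` meets every nonempty finite
intersection of sets `F j`, `H j` with `j < i`. If the `F i` with `i` in an uncountable set `S` are
centered, the pairs `(F i, H i)` with `i ∈ S` form a free sequence, which countable tightness
forbids.

To find `S`, condition `μ` on a set `G` that is almost covered by `{F j | i ≤ j}` for every `i`, and
consider the random set `{i | x ∈ F i}`. Almost surely it meets a given `{j | i ≤ j}`, and almost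
surely a given finite set of indices either is not contained in it or belongs to sets `F i` with a
common point. These are `ω₁` events, which need not hold together for any `x ∈ K`. But the law of
the random set is an image of `λ_{ω₁}`: decide the indices one after another, each with its
conditional law given the previous decisions, using countably many fresh coins every time. As
`cov(𝒩_{ω₁}) > ω₁`, some outcome in `2^{ω₁}` satisfies all of them, and it determines `S`.
-/

universe v

namespace SmallCompacta

open Set Topology ProbabilityTheory unitInterval
open scoped NNReal ENNReal

section Order

variable {ι : Type*} [LinearOrder ι]

theorem exists_forall_mem_lt [Uncountable ι] (hι : ∀ i : ι, (Iio i).Countable) {C : Set ι}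
    (hC : C.Countable) : ∃ i, ∀ c ∈ C, c < i := by
  by_contra! h
  refine not_countable_univ ((hC.biUnion fun c _ ↦ (hι c).insert c).mono fun i _ ↦ ?_)
  obtain ⟨c, hc, hic⟩ := h i
  exact mem_biUnion hc (by simpa [le_iff_eq_or_lt] using hic)

theorem exists_forall_image_Iio [WellFoundedLT ι] (hι : ∀ i : ι, (Iio i).Countable) {α : Type*}
    {R : Set α → α → Prop} (hR : ∀ G : Set α, G.Countable → ∃ a, R G a) :
    ∃ φ : ι → α, ∀ i, R (φ '' Iio i) (φ i) := by
  have : Nonempty α := ⟨(hR ∅ countable_empty).choose⟩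
  choose! next hnext using hR
  let φ : ι → α := wellFounded_lt.fix fun i r ↦ next (range fun j : Iio i ↦ r j j.2)
  refine ⟨φ, fun i ↦ ?_⟩
  have hφ : φ i = next (φ '' Iio i) := by
    rw [image_eq_range]
    exact wellFounded_lt.fix_eq _ i
  rw [hφ]
  exact hnext _ ((hι i).image φ)

theorem countable_Iio_ord_toType_aleph_one (i : (aleph.{v} 1).ord.ToType) : (Iio i).Countable := by
  rw [← le_aleph0_iff_set_countable, ← Order.lt_succ_iff, succ_aleph0]
  exact (mk_Iio_lt i (by simp)).trans_eq (mk_ord_toType _)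

end Order

section FreeSequence

/-- The members of `F` with index in `S` form a centered family: any finitely many of them have a
common point. -/
def IsCentered {ι X : Type*} (F : ι → Set X) (S : Set ι) : Prop :=
  ∀ s : Finset ι, ↑s ⊆ S → (⋂ i ∈ s, F i).Nonempty

/-- A free sequence, in its algebraic form: a sequence of pairs of disjoint closed sets `F i`, `H i`
such that finitely many `F i` always meet finitely many later `H j`. In a compact space this is
the same as a sequence of points `x i` such that the closures of `{x j | j < i}` and
`{x j | i ≤ j}` are disjoint for all `i`. -/
structure IsFreeSequence {ι K : Type*} [LT ι] [TopologicalSpace K] (F H : ι → Set K) : Prop where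
  isClosed_left (i : ι) : IsClosed (F i)
  isClosed_right (i : ι) : IsClosed (H i)
  disjoint (i : ι) : Disjoint (F i) (H i)
  nonempty (s t : Finset ι) : (∀ i ∈ s, ∀ j ∈ t, i < j) →
    ((⋂ i ∈ s, F i) ∩ ⋂ j ∈ t, H j).Nonempty

variable {ι : Type*} [LinearOrder ι] {K : Type u} [TopologicalSpace K]

theorem IsFreeSequence.exists_points [CompactSpace K] {F H : ι → Set K}
    (h : IsFreeSequence F H) :
    ∃ x : ι → K, ∀ i j, (j < i → x i ∈ F j) ∧ (i ≤ j → x i ∈ H j) := by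
  have hne (i : ι) : (⋂ j, if j < i then F j else H j).Nonempty := by
    refine CompactSpace.iInter_nonempty (fun j ↦ ?_) fun t ↦ ?_
    · split_ifs
      exacts [h.isClosed_left j, h.isClosed_right j]
    · obtain ⟨x, hxF, hxH⟩ := h.nonempty {j ∈ t | j < i} {j ∈ t | i ≤ j} fun a ha b hb ↦
        (Finset.mem_filter.1 ha).2.trans_le (Finset.mem_filter.1 hb).2
      simp only [Finset.mem_filter, mem_iInter, and_imp] at hxF hxH
      refine ⟨x, mem_iInter₂.2 fun j hj ↦ ?_⟩
      split_ifs with hji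
      exacts [hxF j hj hji, hxH j hj (not_lt.1 hji)]
  choose x hx using hne
  refine ⟨x, fun i j ↦ ⟨fun hji ↦ ?_, fun hij ↦ ?_⟩⟩
  · simpa only [if_pos hji] using mem_iInter.1 (hx i) j
  · simpa only [if_neg hij.not_gt] using mem_iInter.1 (hx i) j

theorem exists_mem_closure_image_Ioi [Nonempty ι] [NoMaxOrder ι] [CompactSpace K] (x : ι → K) :
    ∃ z, ∀ i, z ∈ closure (x '' Ioi i) := by
  simp only [← mem_iInter]
  refine IsCompact.nonempty_iInter_of_directed_nonempty_isCompact_isClosed _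
    (directed_of_isDirected_le fun i j hij ↦ closure_mono (image_mono (Ioi_subset_Ioi hij)))
    (fun i ↦ (nonempty_Ioi.image x).closure) (fun i ↦ isClosed_closure.isCompact)
    fun i ↦ isClosed_closure

theorem CountablyTight.countable_of_isFreeSequence [CompactSpace K] (hK : CountablyTight K)
    (hι : ∀ i : ι, (Iio i).Countable) {F H : ι → Set K} (h : IsFreeSequence F H) :
    Countable ι := by
  by_contra hunc
  rw [not_countable_iff] at hunc
  have : NoMaxOrder ι := ⟨fun i ↦ by simpa using exists_forall_mem_lt hι (countable_singleton i)⟩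
  obtain ⟨x, hx⟩ := h.exists_points
  obtain ⟨z, hz⟩ := exists_mem_closure_image_Ioi x
  have hzx : z ∈ closure (range x) :=
    closure_mono (image_subset_range x _) (hz (Classical.arbitrary ι))
  obtain ⟨B, hBx, hB, hzB⟩ := hK _ z hzx
  replace hBx : ∀ b ∈ B, ∃ i, x i = b := hBx
  choose! c hc using hBx
  obtain ⟨i, hi⟩ := exists_forall_mem_lt hι (hB.image c)
  have hzF : z ∈ F i := by
    refine closure_minimal ?_ (h.isClosed_left i) (hz i)
    rintro _ ⟨j, hij, rfl⟩
    exact (hx j i).1 hij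
  have hzH : z ∈ H i := by
    refine closure_minimal (fun b hb ↦ ?_) (h.isClosed_right i) hzB
    rw [← hc b hb]
    exact (hx (c b) i).2 (hi _ (mem_image_of_mem c hb)).le
  exact (h.disjoint i).notMem_of_mem_left hzF hzH

end FreeSequence

section PiBase

theorem exists_disjoint_zeroSets {K : Type*} [TopologicalSpace K] [NormalSpace K] [T1Space K]
    {V : Set K} (hV : IsOpen V) (hVne : V.Nonempty) :
    ∃ f k : C(K, ℝ≥0), (interior (f ⁻¹' {0})).Nonempty ∧ Disjoint (f ⁻¹' {0}) (k ⁻¹' {0}) ∧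
      Vᶜ ⊆ k ⁻¹' {0} := by
  obtain ⟨v, hv⟩ := hVne
  obtain ⟨h, h0, h1, -⟩ := exists_continuous_zero_one_of_isClosed hV.isClosed_compl
    (isClosed_singleton (x := v)) (disjoint_singleton_right.2 (notMem_compl_iff.2 hv))
  refine ⟨⟨fun x ↦ (2 / 3 - h x).toNNReal, by fun_prop⟩, ⟨fun x ↦ (h x - 1 / 3).toNNReal,
    by fun_prop⟩, ⟨v, ?_⟩, ?_, fun x hx ↦ ?_⟩
  · refine mem_interior.2 ⟨h ⁻¹' Ioi (2 / 3), fun x (hx : 2 / 3 < h x) ↦ ?_,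
      isOpen_Ioi.preimage (map_continuous h), ?_⟩
    · simpa using hx.le
    · rw [mem_preimage, h1 rfl]
      norm_num
  · refine disjoint_left.2 fun x hf hk ↦ ?_
    simp only [ContinuousMap.coe_mk, mem_preimage, mem_singleton_iff,
      Real.toNNReal_eq_zero] at hf hk
    linarith
  · simp [h0 hx]

variable {K : Type u} [TopologicalSpace K] [CompactSpace K]

theorem exists_isOpen_forall_not_fiber_subset
    (hK : ¬ ∃ P : Set (Set K), P.Countable ∧ IsPiBase P) {Y : Type*} [TopologicalSpace Y]
    [T2Space Y] [SecondCountableTopology Y] {𝒢 : Set C(K, Y)} (h𝒢 : 𝒢.Countable) (y : Y) :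
    ∃ V : Set K, IsOpen V ∧ V.Nonempty ∧ ∀ g ∈ 𝒢, (g ⁻¹' {y}).Nonempty → ¬ g ⁻¹' {y} ⊆ V := by
  let P : Set (Set K) :=
    {U ∈ image2 (fun (g : C(K, Y)) B ↦ g ⁻¹' B) 𝒢 (TopologicalSpace.countableBasis Y) | U.Nonempty}
  have hPc : P.Countable :=
    (h𝒢.image2 (TopologicalSpace.countable_countableBasis Y) _).mono (sep_subset _ _)
  have hPo : ∀ U ∈ P, IsOpen U ∧ U.Nonempty := by
    rintro _ ⟨⟨g, -, B, hB, rfl⟩, hne⟩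
    exact ⟨(TopologicalSpace.isOpen_of_mem_countableBasis hB).preimage (map_continuous g), hne⟩
  obtain ⟨V, hV, hVne, hPV⟩ : ∃ V : Set K, IsOpen V ∧ V.Nonempty ∧ ∀ U ∈ P, ¬ U ⊆ V := by
    by_contra! h
    exact hK ⟨P, hPc, hPo, h⟩
  refine ⟨V, hV, hVne, fun g hg hne hgV ↦ ?_⟩
  -- a continuous map on a compact space is closed, so fibres have tubular neighbourhood bases
  have hVy : V ∈ (𝓝 y).comap g := by
    rw [(map_continuous g).isClosedMap.comap_nhds_eq (map_continuous g)]
    exact hV.mem_nhdsSet.2 hgV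
  obtain ⟨B, ⟨hB, hyB⟩, hBV⟩ :=
    ((TopologicalSpace.isBasis_countableBasis Y).nhds_hasBasis.comap g).mem_iff.1 hVy
  exact hPV _ ⟨⟨g, hg, B, hB, rfl⟩, hne.mono (preimage_mono (singleton_subset_iff.2 hyB))⟩ hBV

theorem exists_zeroSets_of_countable [T2Space K]
    (hK : ¬ ∃ P : Set (Set K), P.Countable ∧ IsPiBase P) {G : Set (C(K, ℝ≥0) × C(K, ℝ≥0))}
    (hG : G.Countable) :
    ∃ p : C(K, ℝ≥0) × C(K, ℝ≥0),
      (interior (p.1 ⁻¹' {0})).Nonempty ∧ Disjoint (p.1 ⁻¹' {0}) (p.2 ⁻¹' {0}) ∧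
      ∀ s t : Finset (C(K, ℝ≥0) × C(K, ℝ≥0)), ↑s ⊆ G → ↑t ⊆ G →
        ((⋂ q ∈ s, q.1 ⁻¹' {0}) ∩ ⋂ q ∈ t, q.2 ⁻¹' {0}).Nonempty →
        (((⋂ q ∈ s, q.1 ⁻¹' {0}) ∩ ⋂ q ∈ t, q.2 ⁻¹' {0}) ∩ p.2 ⁻¹' {0}).Nonempty := by
  let total (s t : Finset (C(K, ℝ≥0) × C(K, ℝ≥0))) : C(K, ℝ≥0) := ∑ q ∈ s, q.1 + ∑ q ∈ t, q.2
  have hzero : ∀ s t, total s t ⁻¹' {0} = (⋂ q ∈ s, q.1 ⁻¹' {0}) ∩ ⋂ q ∈ t, q.2 ⁻¹' {0} := by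
    intro s t
    ext x
    simp [total]
  have hfin : {s : Finset (C(K, ℝ≥0) × C(K, ℝ≥0)) | ↑s ⊆ G}.Countable := by
    simpa using (countable_ofPred_finite_subset hG).preimage Finset.coe_injective
  obtain ⟨V, hV, hVne, hGV⟩ :=
    exists_isOpen_forall_not_fiber_subset hK (hfin.image2 hfin total) 0
  obtain ⟨f, k, hf, hfk, hVk⟩ := exists_disjoint_zeroSets hV hVne
  refine ⟨(f, k), hf, hfk, fun s t hs ht hst ↦ ?_⟩
  rw [← hzero] at hst ⊢
  obtain ⟨x, hx, hxV⟩ := not_subset.1 (hGV (total s t) (mem_image2_of_mem hs ht) hst)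
  exact ⟨x, hx, hVk hxV⟩

variable {ι : Type*} [LinearOrder ι] [WellFoundedLT ι]

theorem exists_closed_pair_sequence [T2Space K]
    (hK : ¬ ∃ P : Set (Set K), P.Countable ∧ IsPiBase P) (hι : ∀ i : ι, (Iio i).Countable) :
    ∃ F H : ι → Set K, (∀ i, IsClosed (F i)) ∧ (∀ i, IsClosed (H i)) ∧
      (∀ i, (interior (F i)).Nonempty) ∧ (∀ i, Disjoint (F i) (H i)) ∧
      ∀ (i : ι) (s t : Finset ι), (∀ j ∈ s, j < i) → (∀ j ∈ t, j < i) →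
        ((⋂ j ∈ s, F j) ∩ ⋂ j ∈ t, H j).Nonempty →
        (((⋂ j ∈ s, F j) ∩ ⋂ j ∈ t, H j) ∩ H i).Nonempty := by
  classical
  obtain ⟨φ, hφ⟩ := exists_forall_image_Iio hι fun _ hG ↦ exists_zeroSets_of_countable hK hG
  refine ⟨fun i ↦ (φ i).1 ⁻¹' {0}, fun i ↦ (φ i).2 ⁻¹' {0},
    fun i ↦ isClosed_singleton.preimage (map_continuous _),
    fun i ↦ isClosed_singleton.preimage (map_continuous _),
    fun i ↦ (hφ i).1, fun i ↦ (hφ i).2.1, fun i s t hs ht ↦ ?_⟩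
  have himage : ∀ r : Finset ι, (∀ j ∈ r, j < i) → ↑(r.image φ) ⊆ φ '' Iio i := fun r hr ↦ by
    rw [Finset.coe_image]
    exact image_mono hr
  simpa only [Finset.set_biInter_finset_image] using
    (hφ i).2.2 (s.image φ) (t.image φ) (himage s hs) (himage t ht)

theorem CountablyTight.exists_countable_isPiBase [T2Space K] (hK : CountablyTight K)
    (hι : ∀ i : ι, (Iio i).Countable)
    (hcent : ∀ F : ι → Set K, (∀ i, IsClosed (F i)) → (∀ i, (interior (F i)).Nonempty) →
      ∃ S : Set ι, ¬ S.Countable ∧ IsCentered F S) :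
    ∃ P : Set (Set K), P.Countable ∧ IsPiBase P := by
  classical
  by_contra hP
  obtain ⟨F, H, hF, hH, hFi, hFH, hstep⟩ := exists_closed_pair_sequence hP hι
  obtain ⟨S, hS, hSF⟩ := hcent F hF hFi
  have hfree (s t : Finset ι) (hs : ↑s ⊆ S) (hst : ∀ i ∈ s, ∀ j ∈ t, i < j) :
      ((⋂ i ∈ s, F i) ∩ ⋂ j ∈ t, H j).Nonempty := by
    induction t using Finset.induction_on_max with
    | empty => simpa using hSF s hs
    | insert a t hat ih =>
      have := hstep a s t (fun i hi ↦ hst i hi a (Finset.mem_insert_self a t)) hat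
        (ih fun i hi j hj ↦ hst i hi j (Finset.mem_insert_of_mem hj))
      rwa [Finset.set_biInter_insert, inter_comm (H a), ← inter_assoc]
  have hsub : IsFreeSequence (fun i : S ↦ F i) fun i : S ↦ H i :=
    ⟨fun i ↦ hF i, fun i ↦ hH i, fun i ↦ hFH i, fun s t hst ↦ by
      have := hfree (s.image Subtype.val) (t.image Subtype.val) (by simp)
        (by simpa [Finset.forall_mem_image] using hst)
      simpa only [Finset.set_biInter_finset_image] using this⟩
  exact hS (hK.countable_of_isFreeSequence
    (fun i : S ↦ (hι i).preimage Subtype.val_injective) hsub)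

end PiBase

section ProductLaws

variable {ι : Type*} [LinearOrder ι] {E : ι → Type*} [∀ i, MeasurableSpace (E i)]

theorem ext_of_map_domRestrict_Iic {μ ν : Measure (∀ i, E i)} [IsProbabilityMeasure μ]
    [IsProbabilityMeasure ν]
    (h : ∀ i, μ.map (Iic i).domRestrict = ν.map (Iic i).domRestrict) : μ = ν := by
  refine IsProjectiveLimit.unique (P := fun s ↦ ν.map s.restrict)
    (fun s ↦ show μ.map s.restrict = ν.map s.restrict from ?_) fun s ↦ rfl
  obtain rfl | hs := s.eq_empty_or_nonempty
  · have hr : Finset.restrict (π := E) ∅ = fun _ ↦ isEmptyElim :=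
      funext fun _ ↦ Subsingleton.elim _ _
    simp [hr, Measure.map_const]
  · let r (x : ∀ j : Iic (s.max' hs), E j) (j : s) : E j := x ⟨j, s.le_max' j j.2⟩
    have hr : Measurable r := by fun_prop
    have hrs : s.restrict = r ∘ (Iic (s.max' hs)).domRestrict := rfl
    rw [hrs, ← Measure.map_map hr (by fun_prop), h, Measure.map_map hr (by fun_prop)]

theorem exists_measurable_domRestrict_Iio_eq_domRestrict_Iic (i : ι) :
    ∃ g : (∀ j : Iio i, E j) × E i → ∀ j : Iic i, E j,
      Measurable g ∧
        ∀ y : ∀ i, E i, g ((Iio i).domRestrict y, y i) = (Iic i).domRestrict y := by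
  refine ⟨fun p j ↦ if h : j < i then p.1 ⟨j, h⟩ else
      cast (congrArg E (j.2.eq_of_not_lt h).symm) p.2,
    measurable_pi_lambda _ fun ⟨j, hj⟩ ↦ ?_, fun y ↦ funext fun ⟨j, hj⟩ ↦ ?_⟩
  · obtain hji | rfl := hj.lt_or_eq
    · simp only [hji, dite_true]
      fun_prop
    · simp only [lt_irrefl, dite_false]
      exact measurable_snd
  · obtain hji | rfl := hj.lt_or_eq
    · simp [hji]
    · simp

theorem eq_of_forall_map_domRestrict_Iio [WellFoundedLT ι] {μ ν : Measure (∀ i, E i)}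
    [IsProbabilityMeasure μ] [IsProbabilityMeasure ν]
    (h : ∀ i, μ.map (Iio i).domRestrict = ν.map (Iio i).domRestrict →
      μ.map (fun y ↦ ((Iio i).domRestrict y, y i)) = ν.map fun y ↦ ((Iio i).domRestrict y, y i)) :
    μ = ν := by
  have hIic (i : ι) (hi : μ.map (Iio i).domRestrict = ν.map (Iio i).domRestrict) :
      μ.map (Iic i).domRestrict = ν.map (Iic i).domRestrict := by
    obtain ⟨g, hg, hgy⟩ := exists_measurable_domRestrict_Iio_eq_domRestrict_Iic (E := E) i
    have hcomp : (Iic i).domRestrict = g ∘ fun y ↦ ((Iio i).domRestrict y, y i) :=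
      funext fun y ↦ (hgy y).symm
    rw [hcomp, ← Measure.map_map hg (by fun_prop), h i hi, Measure.map_map hg (by fun_prop)]
  refine ext_of_map_domRestrict_Iic fun i ↦ hIic i ?_
  induction i using WellFoundedLT.induction with
  | _ i ih =>
    have (ρ : Measure (∀ i, E i)) [IsProbabilityMeasure ρ] :
        IsProbabilityMeasure (ρ.map (Iio i).domRestrict) :=
      Measure.isProbabilityMeasure_map (by fun_prop)
    refine ext_of_map_domRestrict_Iic fun j ↦ ?_
    let r (x : ∀ k : Iic j.1, E k) (k : Iic j) : E k := x ⟨k, k.2⟩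
    have hr : Measurable r := by fun_prop
    have hcomp : (Iic j).domRestrict ∘ (Iio i).domRestrict =
        r ∘ (Iic j.1).domRestrict (π := E) := rfl
    simp only [Measure.map_map (Set.measurable_restrict _) (Set.measurable_restrict _), hcomp]
    rw [← Measure.map_map hr (by fun_prop), hIic j (ih j j.2), Measure.map_map hr (by fun_prop)]

end ProductLaws

section Independence

variable {ι : Type*} {U : ι → Type*} [∀ i, MeasurableSpace (U i)]

theorem indepFun_infinitePi_of_disjoint {β γ : Type*} [MeasurableSpace β] [MeasurableSpace γ]
    (ρ : ∀ i, Measure (U i)) [∀ i, IsProbabilityMeasure (ρ i)] {S T : Set ι} (hST : Disjoint S T)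
    {X : (∀ i, U i) → β} {Y : (∀ i, U i) → γ}
    (hX : Measurable[⨆ i ∈ S, MeasurableSpace.comap (Function.eval i) inferInstance] X)
    (hY : Measurable[⨆ i ∈ T, MeasurableSpace.comap (Function.eval i) inferInstance] Y) :
    X ⟂ᵢ[Measure.infinitePi ρ] Y := by
  have h : iIndepFun (fun i ↦ Function.eval i) (Measure.infinitePi ρ) :=
    iIndepFun_infinitePi (X := fun _ x ↦ x) fun _ ↦ measurable_id
  have h' := indep_iSup_of_disjoint (fun i ↦ (measurable_pi_apply i).comap_le) h.iIndep hST
  rw [IndepFun_iff_Indep]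
  exact indep_of_indep_of_le_left (indep_of_indep_of_le_right h' hY.comap_le) hX.comap_le

theorem measurable_eval_iSup_comap {S : Set ι} {i : ι} (hi : i ∈ S) :
    Measurable[⨆ j ∈ S, MeasurableSpace.comap (Function.eval j) inferInstance]
      fun u : ∀ i, U i ↦ u i :=
  (comap_measurable _).mono (le_iSup₂_of_le i hi le_rfl) le_rfl

end Independence

section Sampling

variable {ι : Type*} [LinearOrder ι] [WellFoundedLT ι] {U E : ι → Type*}

/-- The result of drawing the coordinates of a point of `∀ i, E i` successively: the `i`-th
coordinate is found by the rule `T i` from the previous ones and the random input `u i`. -/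
noncomputable def successiveSample (T : ∀ i, (∀ j : Iio i, E j) → U i → E i) (u : ∀ i, U i) :
    ∀ i, E i :=
  wellFounded_lt.fix fun i past ↦ T i (fun j ↦ past j j.2) (u i)

theorem successiveSample_apply (T : ∀ i, (∀ j : Iio i, E j) → U i → E i) (u : ∀ i, U i) (i : ι) :
    successiveSample T u i = T i ((Iio i).domRestrict (successiveSample T u)) (u i) :=
  wellFounded_lt.fix_eq _ i

variable [∀ i, MeasurableSpace (U i)] [∀ i, MeasurableSpace (E i)]
  {T : ∀ i, (∀ j : Iio i, E j) → U i → E i}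

theorem measurable_iSup_comap_successiveSample_apply
    (hT : ∀ i, Measurable (Function.uncurry (T i))) (i : ι) :
    Measurable[⨆ j ∈ Iic i, MeasurableSpace.comap (Function.eval j) inferInstance]
      fun u ↦ successiveSample T u i := by
  induction i using WellFoundedLT.induction with
  | _ i ih =>
    simp only [successiveSample_apply T _ i]
    refine (hT i).comp (@Measurable.prodMk _ _ _ _ _ (_) _ _
      (@measurable_pi_lambda _ _ _ (_) _ _ fun j ↦ ?_) (measurable_eval_iSup_comap self_mem_Iic))
    exact (ih j j.2).mono (biSup_mono fun k (hk : k ≤ j) ↦ hk.trans j.2.le) le_rfl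

theorem measurable_successiveSample (hT : ∀ i, Measurable (Function.uncurry (T i))) :
    Measurable (successiveSample T) :=
  measurable_pi_lambda _ fun i ↦ (measurable_iSup_comap_successiveSample_apply hT i).mono
    (iSup₂_le fun j _ ↦ (measurable_pi_apply j).comap_le) le_rfl

theorem indepFun_domRestrict_Iio_successiveSample (hT : ∀ i, Measurable (Function.uncurry (T i)))
    (ρ : ∀ i, Measure (U i)) [∀ i, IsProbabilityMeasure (ρ i)] (i : ι) :
    (fun u ↦ (Iio i).domRestrict (successiveSample T u)) ⟂ᵢ[Measure.infinitePi ρ] fun u ↦ u i := by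
  refine indepFun_infinitePi_of_disjoint (S := Iio i) (T := {i}) ρ (by simp) ?_
    (measurable_eval_iSup_comap rfl)
  refine @measurable_pi_lambda _ _ _ (_) _ _ fun j ↦ ?_
  exact (measurable_iSup_comap_successiveSample_apply hT j.1).mono
    (biSup_mono fun k (hk : k ≤ j) ↦ hk.trans_lt j.2) le_rfl

theorem map_prod_eq_compProd {X Y V : Type*} [MeasurableSpace X] [MeasurableSpace Y]
    [MeasurableSpace V] {μ : Measure X} [SFinite μ] {ρ : Measure V} [SFinite ρ] {κ : Kernel X Y}
    [IsSFiniteKernel κ] {f : X → V → Y} (hf : Measurable (Function.uncurry f))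
    (hfκ : ∀ x, ρ.map (f x) = κ x) :
    (μ.prod ρ).map (fun p ↦ (p.1, f p.1 p.2)) = μ ⊗ₘ κ := by
  have hg : Measurable fun p : X × V ↦ (p.1, f p.1 p.2) := measurable_fst.prodMk hf
  ext A hA
  rw [Measure.map_apply hg hA, Measure.prod_apply (hg hA), Measure.compProd_apply hA]
  refine lintegral_congr fun x ↦ ?_
  rw [← hfκ, Measure.map_apply (by fun_prop) (measurable_prodMk_left hA)]
  rfl

theorem map_successiveSample_eq_compProd (hT : ∀ i, Measurable (Function.uncurry (T i)))
    (ρ : ∀ i, Measure (U i)) [∀ i, IsProbabilityMeasure (ρ i)] {i : ι}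
    {κ : Kernel (∀ j : Iio i, E j) (E i)} [IsSFiniteKernel κ]
    (hκ : ∀ x, (ρ i).map (T i x) = κ x) :
    ((Measure.infinitePi ρ).map (successiveSample T)).map
        (fun y ↦ ((Iio i).domRestrict y, y i)) =
      ((Measure.infinitePi ρ).map (successiveSample T)).map (Iio i).domRestrict ⊗ₘ κ := by
  have hS := measurable_successiveSample hT
  have hpast : Measurable fun u ↦ (Iio i).domRestrict (successiveSample T u) := by fun_prop
  have hlaw := (indepFun_iff_map_prod_eq_prod_map_map hpast.aemeasurable
    (measurable_pi_apply i).aemeasurable).1 (indepFun_domRestrict_Iio_successiveSample hT ρ i)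
  rw [Measure.infinitePi_map_eval ρ i] at hlaw
  have hcomp : (fun y ↦ ((Iio i).domRestrict y, y i)) ∘ successiveSample T =
      (fun p ↦ (p.1, T i p.1 p.2)) ∘ fun u ↦ ((Iio i).domRestrict (successiveSample T u), u i) :=
    funext fun u ↦ Prod.ext rfl (successiveSample_apply T u i)
  have hstep : Measurable fun p : (∀ j : Iio i, E j) × U i ↦ (p.1, T i p.1 p.2) :=
    measurable_fst.prodMk (hT i)
  rw [Measure.map_map (by fun_prop) hS, Measure.map_map (by fun_prop) hS, hcomp,
    ← Measure.map_map hstep (hpast.prodMk (measurable_pi_apply i)), hlaw]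
  exact map_prod_eq_compProd (hT i) hκ

theorem exists_measurePreserving_infinitePi_volume [∀ i, StandardBorelSpace (E i)]
    (ν : Measure (∀ i, E i)) [IsProbabilityMeasure ν] :
    ∃ f : (ι → I) → ∀ i, E i, MeasurePreserving f (Measure.infinitePi fun _ ↦ volume) ν := by
  have hE (i : ι) : Nonempty (E i) := ν.nonempty_of_neZero.map fun y ↦ y i
  let κ (i : ι) : Kernel (∀ j : Iio i, E j) (E i) :=
    condDistrib (fun y ↦ y i) (Iio i).domRestrict ν
  choose T hT hTκ using fun i ↦ (κ i).exists_measurable_map_eq_unitInterval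
  have hS := measurable_successiveSample hT
  have := Measure.isProbabilityMeasure_map (μ := Measure.infinitePi fun _ : ι ↦ volume)
    hS.aemeasurable
  refine ⟨successiveSample T, hS, eq_of_forall_map_domRestrict_Iio fun i hi ↦ ?_⟩
  rw [map_successiveSample_eq_compProd hT _ (hTκ i), hi,
    compProd_map_condDistrib (measurable_pi_apply i).aemeasurable]

end Sampling

section Cube

theorem exists_cdf_eq (μ : Measure ℝ) [IsProbabilityMeasure μ] [NullSingletonClass μ] {p : ℝ}
    (hp : p ∈ Ioo 0 1) : ∃ x, cdf μ x = p := by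
  have hcont : Continuous (cdf μ) := by
    refine continuous_iff_continuousAt.2 fun x ↦ ?_
    have hx : cdf μ x - Function.leftLim (cdf μ) x ≤ 0 := by
      rw [← ENNReal.ofReal_eq_zero, ← StieltjesFunction.measure_singleton, measure_cdf,
        measure_singleton]
    rw [(monotone_cdf μ).continuousAt_iff_leftLim_eq_rightLim, (cdf μ).rightLim_eq]
    exact ((monotone_cdf μ).leftLim_le le_rfl).antisymm (by linarith)
  exact mem_range_of_exists_le_of_exists_ge hcont
    ((tendsto_cdf_atBot μ).eventually_le_const hp.1).exists
    ((tendsto_cdf_atTop μ).eventually_const_le hp.2).exists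

theorem eq_volume_of_forall_mem_Ioo {μ : Measure I} [IsProbabilityMeasure μ]
    (hIio : ∀ p ∈ Ioo (0 : I) 1, μ.real (Iio p) ≤ p)
    (hIic : ∀ p ∈ Ioo (0 : I) 1, p ≤ μ.real (Iic p)) : μ = volume := by
  refine Measure.ext_of_Iic _ _ fun p ↦ ?_
  rw [volume_Iic, ← ofReal_measureReal]
  congr 1
  refine le_antisymm (le_of_forall_gt_imp_ge_of_dense fun a ha ↦ ?_) ?_
  · obtain h1 | h1 := le_or_gt 1 a
    · exact measureReal_le_one.trans h1
    · let q : I := ⟨a, p.2.1.trans ha.le, h1.le⟩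
      exact (measureReal_mono (Iic_subset_Iio.2 (show p < q from ha))).trans
        (hIio q ⟨p.2.1.trans_lt ha, h1⟩)
  · obtain rfl | h0 := eq_zero_or_pos p
    · exact measureReal_nonneg
    obtain rfl | h1 := (le_one' : p ≤ 1).eq_or_lt
    · have : Iic (1 : I) = Set.univ := Iic_top
      simp [this]
    · exact hIic p ⟨h0, h1⟩

theorem exists_measurePreserving_unitInterval {X : Type*} [MeasurableSpace X]
    [StandardBorelSpace X] (μ : Measure X) [IsProbabilityMeasure μ] [NullSingletonClass μ] :
    ∃ f : X → I, MeasurePreserving f μ volume := by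
  have he := measurableEmbedding_embeddingReal X
  let ν : Measure ℝ := μ.map (embeddingReal X)
  have : IsProbabilityMeasure ν := Measure.isProbabilityMeasure_map he.measurable.aemeasurable
  have : NullSingletonClass ν := ⟨fun x ↦ by
    rw [he.map_apply]
    exact (subsingleton_singleton.preimage he.injective).measure_zero μ⟩
  let F (x : ℝ) : I := ⟨cdf ν x, cdf_nonneg ν x, cdf_le_one ν x⟩
  have hF : Measurable F := (monotone_cdf ν).measurable.subtype_mk
  have := Measure.isProbabilityMeasure_map (μ := ν) hF.aemeasurable
  have hFν : MeasurePreserving F ν volume := by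
    refine ⟨hF, eq_volume_of_forall_mem_Ioo (fun p hp ↦ ?_) fun p hp ↦ ?_⟩
    all_goals obtain ⟨x, hx⟩ := exists_cdf_eq ν (p := p) hp
    · rw [map_measureReal_apply hF measurableSet_Iio, ← hx, ProbabilityTheory.cdf_eq_real]
      refine measureReal_mono fun y (hy : cdf ν y < p) ↦ ?_
      exact ((monotone_cdf ν).reflect_lt (hy.trans_eq hx.symm)).le
    · rw [map_measureReal_apply hF measurableSet_Iic, ← hx, ProbabilityTheory.cdf_eq_real]
      exact measureReal_mono fun y hy ↦ (monotone_cdf ν hy).trans_eq hx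
  exact ⟨_, hFν.comp ⟨he.measurable, rfl⟩⟩

/-- The measure of a fair coin. -/
noncomputable abbrev coin : Measure Bool := (PMF.uniformOfFintype Bool).toMeasure

/-- The law of an infinite sequence of tosses of a fair coin. -/
noncomputable abbrev coinSeq : Measure (ℕ → Bool) := Measure.infinitePi fun _ ↦ coin

instance : NullSingletonClass coinSeq where
  measure_singleton y := by
    have (b : Bool) : coin {b} = 2⁻¹ := by
      rw [PMF.toMeasure_apply_singleton _ _ (measurableSet_singleton b)]
      simp
    have hle (n : ℕ) : coinSeq {y} ≤ 2⁻¹ ^ n := by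
      calc coinSeq {y} ≤ coinSeq ((Finset.range n : Set ℕ).pi fun i ↦ {y i}) :=
            measure_mono fun z hz i _ ↦ congrFun hz i
        _ = 2⁻¹ ^ n := by
          rw [Measure.infinitePi_pi _ fun i _ ↦ measurableSet_singleton (y i)]
          simp [this]
    exact le_antisymm (ge_of_tendsto' (ENNReal.tendsto_pow_atTop_nhds_zero_of_lt_one (by simp)) hle)
      zero_le

theorem exists_measurePreserving_cubeMeasure {κ : Cardinal.{u}} (hκ : ℵ₀ ≤ κ) {ι : Type u}
    (hι : #ι ≤ κ) {E : ι → Type*} [∀ i, MeasurableSpace (E i)] [∀ i, StandardBorelSpace (E i)]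
    (ν : Measure (∀ i, E i)) [IsProbabilityMeasure ν] :
    ∃ f : Cube κ → ∀ i, E i, MeasurePreserving f (cubeMeasure κ) ν := by
  obtain ⟨e⟩ : #(ι × ℕ) ≤ #κ.out := by
    rw [mk_out, mk_prod, lift_uzero, mk_nat, lift_aleph0]
    exact (mul_le_mul' hι hκ).trans_eq (mul_eq_self hκ)
  obtain ⟨f, hf⟩ := exists_measurePreserving_unitInterval coinSeq
  obtain ⟨_, _⟩ := exists_wellFoundedLT ι
  obtain ⟨g, hg⟩ := exists_measurePreserving_infinitePi_volume ν
  have hsel : MeasurePreserving (fun (ω : Cube κ) (q : ι × ℕ) ↦ ω (e q)) (cubeMeasure κ)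
      (Measure.infinitePi fun _ ↦ coin) :=
    ⟨by fun_prop, Measure.map_infinitePi_infinitePi_of_inj (P := fun _ ↦ coin) e.injective⟩
  have hcurry : MeasurePreserving (MeasurableEquiv.curry ι ℕ Bool)
      (Measure.infinitePi fun _ ↦ coin) (Measure.infinitePi fun _ ↦ coinSeq) :=
    ⟨MeasurableEquiv.measurable _, Measure.infinitePi_map_curry fun _ _ ↦ coin⟩
  have hunif : MeasurePreserving (fun (ω : ι → ℕ → Bool) i ↦ f (ω i))
      (Measure.infinitePi fun _ ↦ coinSeq) (Measure.infinitePi fun _ ↦ volume) :=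
    ⟨measurable_pi_lambda _ fun i ↦ hf.measurable.comp (measurable_pi_apply i), by
      rw [Measure.infinitePi_map_pi (μ := fun _ : ι ↦ coinSeq) fun _ ↦ hf.measurable, hf.map_eq]⟩
  exact ⟨_, hg.comp (hunif.comp (hcurry.comp hsel))⟩

theorem exists_forall_of_lt_cov {κ : Cardinal.{u}} (hκ : ℵ₀ ≤ κ)
    (hcov : κ < cov (cubeNullIdeal κ)) {ι : Type u} (hι : #ι ≤ κ) {E : ι → Type*}
    [∀ i, MeasurableSpace (E i)] [∀ i, StandardBorelSpace (E i)] (ν : Measure (∀ i, E i))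
    [IsProbabilityMeasure ν] {β : Type u} (hβ : #β ≤ κ) {p : β → (∀ i, E i) → Prop}
    (hp : ∀ b, ∀ᵐ y ∂ν, p b y) : ∃ y, ∀ b, p b y := by
  obtain ⟨f, hf⟩ := exists_measurePreserving_cubeMeasure hκ hι ν
  by_contra! h
  refine hcov.not_ge (le_trans (csInf_le' ⟨range fun b ↦ {ω | ¬ p b (f ω)}, ?_, ?_, rfl⟩)
    (mk_range_le.trans hβ))
  · rintro _ ⟨b, rfl⟩
    exact hf.quasiMeasurePreserving.ae (hp b)
  · refine eq_univ_of_forall fun ω ↦ ?_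
    obtain ⟨b, hb⟩ := h (f ω)
    exact ⟨_, ⟨b, rfl⟩, hb⟩

end Cube

section Centered

variable {X : Type*} [MeasurableSpace X] (μ : Measure X) [SFinite μ]

theorem exists_countable_forall_ae_le_biUnion {α : Type*} {A : α → Set X}
    (hA : ∀ i, MeasurableSet (A i)) (T : Set α) :
    ∃ J ⊆ T, J.Countable ∧ ∀ i ∈ T, A i ≤ᵐ[μ] ⋃ j ∈ J, A j := by
  obtain ⟨D, hDT, hD, hAD⟩ := Measure.exists_ae_subset_biUnion_countable μ (C := A '' T)
    (forall_mem_image.2 fun i _ ↦ hA i)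
  obtain ⟨J, hJT, hJD⟩ := SurjOn.exists_bijOn_subset hDT
  refine ⟨J, hJT, countable_of_injective_of_countable_image hJD.injOn (hJD.image_eq ▸ hD),
    fun i hi ↦ ?_⟩
  rw [← sUnion_image, hJD.image_eq]
  exact hAD _ (mem_image_of_mem A hi)

variable {ι : Type v} [LinearOrder ι] [Uncountable ι]

theorem exists_forall_ae_le (hι : ∀ i : ι, (Iio i).Countable) {G : ι → Set X}
    (hG : ∀ i, MeasurableSet (G i)) (hanti : ∀ i j, i ≤ j → G j ≤ᵐ[μ] G i) :
    ∃ a, ∀ i, G a ≤ᵐ[μ] G i := by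
  obtain ⟨C, -, hC, hGC⟩ :=
    exists_countable_forall_ae_le_biUnion μ (fun i ↦ (hG i).compl) Set.univ
  obtain ⟨a, ha⟩ := exists_forall_mem_lt hι hC
  refine ⟨a, fun i ↦ ?_⟩
  filter_upwards [(ae_ball_iff hC).2 fun c hc ↦ hanti c a (ha c hc).le, hGC i (mem_univ i)]
    with x hxC hxi hxa
  by_contra hx
  obtain ⟨c, hc, hxc⟩ := mem_iUnion₂.1 (hxi hx)
  exact hxc (hxC c hc hxa)

theorem exists_measurableSet_forall_ae_le_biUnion (hι : ∀ i : ι, (Iio i).Countable)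
    {F : ι → Set X} (hF : ∀ i, MeasurableSet (F i)) (hF0 : ∀ i, μ (F i) ≠ 0) :
    ∃ G, MeasurableSet G ∧ μ G ≠ 0 ∧
      ∀ i, ∃ J ⊆ Ici i, J.Countable ∧ G ≤ᵐ[μ] ⋃ j ∈ J, F j := by
  choose J hJi hJ hFJ using fun i ↦ exists_countable_forall_ae_le_biUnion μ hF (Ici i)
  have hG (i : ι) : MeasurableSet (⋃ j ∈ J i, F j) := .biUnion (hJ i) fun j _ ↦ hF j
  obtain ⟨a, ha⟩ := exists_forall_ae_le μ hι hG fun i j hij ↦ by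
    filter_upwards [(ae_ball_iff (hJ j)).2 fun k hk ↦ hFJ i k (hij.trans (hJi j hk))]
      with x hx hxj
    obtain ⟨k, hk, hxk⟩ := mem_iUnion₂.1 hxj
    exact hx k hk hxk
  exact ⟨_, hG a, fun h0 ↦ hF0 a (measure_mono_null_ae (hFJ a a self_mem_Ici) h0),
    fun i ↦ ⟨J i, hJi i, hJ i, ha i⟩⟩

theorem exists_set_forall_of_lt_cov {κ : Cardinal.{u}} (hκ : ℵ₀ ≤ κ)
    (hcov : κ < cov (cubeNullIdeal κ)) {X : Type*} [MeasurableSpace X] (μ : Measure X)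
    [IsProbabilityMeasure μ] {ι : Type u} (hι : #ι ≤ κ) {F : ι → Set X}
    (hF : ∀ i, MeasurableSet (F i)) {β : Type u} (hβ : #β ≤ κ) {p : β → Set ι → Prop}
    (hpm : ∀ b, Measurable (p b)) (hp : ∀ b, ∀ᵐ x ∂μ, p b {i | x ∈ F i}) :
    ∃ T, ∀ b, p b T := by
  let φ (x : X) (i : ι) : Prop := x ∈ F i
  have hφ : Measurable φ := measurable_pi_lambda _ fun i ↦ (hF i).mem
  have := Measure.isProbabilityMeasure_map (μ := μ) hφ.aemeasurable
  obtain ⟨y, hy⟩ := exists_forall_of_lt_cov hκ hcov hι (μ.map φ) hβ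
    (p := fun b y ↦ p b {i | y i}) fun b ↦
      (ae_map_iff hφ.aemeasurable ((hpm b).comp measurable_setOfPred).setOf).2 (hp b)
  exact ⟨{i | y i}, hy⟩

theorem exists_uncountable_isCentered {κ : Cardinal.{v}} (hcov : κ < cov (cubeNullIdeal κ))
    (hικ : #ι ≤ κ) (hι : ∀ i : ι, (Iio i).Countable) {F : ι → Set X}
    (hF : ∀ i, MeasurableSet (F i)) (hF0 : ∀ i, μ (F i) ≠ 0) :
    ∃ S : Set ι, ¬ S.Countable ∧ IsCentered F S := by
  obtain ⟨G, hG, hG0, hGF⟩ := exists_measurableSet_forall_ae_le_biUnion μ.toFinite hι hF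
    fun i ↦ by simpa using hF0 i
  choose J hJi hJ hGJ using hGF
  have := cond_isProbabilityMeasure hG0
  have hκ : ℵ₀ ≤ κ := (aleph0_le_mk ι).trans hικ
  have hβ : #(ι ⊕ Finset ι) ≤ κ := by simpa using add_le_of_le hκ hικ hικ
  let p : ι ⊕ Finset ι → Set ι → Prop :=
    Sum.elim (fun i T ↦ ∃ j : J i, ↑j ∈ T) fun s T ↦ (∀ i : s, ↑i ∈ T) → (⋂ i ∈ s, F i).Nonempty
  have hpm (b) : Measurable (p b) := by
    rcases b with i | s
    · have := (hJ i).to_subtype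
      exact .exists fun j ↦ measurable_set_mem _
    · exact .imp (.forall fun i ↦ measurable_set_mem _) measurable_const
  have hp (b) : ∀ᵐ x ∂μ.toFinite[|G], p b {i | x ∈ F i} := by
    rcases b with i | s
    · filter_upwards [ae_cond_mem hG, cond_absolutelyContinuous.ae_le (hGJ i)] with x hxG hx
      obtain ⟨j, hj, hxj⟩ := mem_iUnion₂.1 (hx hxG)
      exact ⟨⟨j, hj⟩, hxj⟩
    · exact .of_forall fun x hx ↦ ⟨x, mem_iInter₂.2 fun i hi ↦ hx ⟨i, hi⟩⟩
  obtain ⟨S, hS⟩ := exists_set_forall_of_lt_cov hκ hcov (μ.toFinite[|G]) hικ hF hβ hpm hp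
  refine ⟨S, fun hSc ↦ ?_, fun s hs ↦ hS (.inr s) fun i ↦ hs i.2⟩
  obtain ⟨i, hi⟩ := exists_forall_mem_lt hι hSc
  obtain ⟨⟨j, hj⟩, hjS⟩ := hS (.inl i)
  exact (hi j hjS).not_ge (hJi i hj)

end Centered

end SmallCompacta

theorem corollary4p5_general
    (hcov : aleph.{0} 1 < SmallCompacta.cov (SmallCompacta.cubeNullIdeal (aleph.{0} 1)))
    (K : Type u) [TopologicalSpace K] [CompactSpace K] [T2Space K] [MeasurableSpace K]
    [OpensMeasurableSpace K] (hK : SmallCompacta.CountablyTight K) (μ : Measure K) [SFinite μ]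
    [μ.IsOpenPosMeasure] : ∃ P : Set (Set K), P.Countable ∧ SmallCompacta.IsPiBase P := by
  have hcard : #(aleph.{0} 1).ord.ToType = aleph 1 := mk_ord_toType _
  have : Uncountable (aleph.{0} 1).ord.ToType :=
    aleph0_lt_mk_iff.1 (aleph0_lt_aleph_one.trans_eq hcard.symm)
  have hι := SmallCompacta.countable_Iio_ord_toType_aleph_one
  refine hK.exists_countable_isPiBase hι fun F hF hFi ↦ ?_
  exact SmallCompacta.exists_uncountable_isCentered μ hcov hcard.le hι
    (fun i ↦ (hF i).measurableSet) fun i ↦ (Measure.measure_pos_of_nonempty_interior μ (hFi i)).ne'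

theorem corollary4p5
    (hcov : Cardinal.aleph.{0} 1 < SmallCompacta.cov (SmallCompacta.cubeNullIdeal (Cardinal.aleph.{0} 1)))
    (K : Type u) [TopologicalSpace K] [CompactSpace K] [T2Space K]
    [MeasurableSpace K] [BorelSpace K]
    (hK : SmallCompacta.CountablyTight K) (hμ : SmallCompacta.SupportsMeasure K) :
    ∃ P : Set (Set K), P.Countable ∧ SmallCompacta.IsPiBase P := by
  obtain ⟨μ, hfin, -, hpos⟩ := hμ
  have : μ.IsOpenPosMeasure := ⟨fun U hU hne ↦ (hpos U hU hne).ne'⟩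
  exact corollary4p5_general hcov K hK μ
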